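/- Let $\Gamma$ be a torsion-free abelian group and let $\mathsf{E}=\bigoplus_{\gamma\in\Gamma}\mathsf{E}_\gamma$ be a graded division ring, i.e., a nonzero graded ring in which every nonzero homogeneous element is invertible. Assume that $\mathsf{E}$ is finite-dimensional over its center $\mathsf{T}=Z(\mathsf{E})$. Let $\tau$ be a unitary graded involution on $\mathsf{E}$: an anti-automorphism with $\tau^2=\mathrm{id}$, $\tau(\mathsf{E}_\gamma)=\mathsf{E}_\gamma$ for all $\gamma$, and $\tau|_{\mathsf{T}}\neq\mathrm{id}$. Put $\mathsf{R}=\mathsf{T}^\tau=\{t\in\mathsf{T}\mid\tau(t)=t\}$. For a graded subring $\mathsf{S}$ of $\mathsf{E}$ let $\Gamma_{\mathsf{S}}=\{\gamma\in\Gamma\mid \mathsf{S}\cap\mathsf{E}_\gamma\neq0\}$. Define $$\mathrm{SK}_1(\mathsf{E},\tau)=\{a\in\mathsf{E}^*\mid \mathrm{Nrd}_{\mathsf{E}}(a\,\tau(a)^{-1})=1\}\,\big/\,\langle a\in\mathsf{E}^*\mid\tau(a)=a\rangle,$$ where $\mathrm{Nrd}_{\mathsf{E}}$ is the restriction to $\mathsf{E}^*$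 of the reduced norm of the quotient division ring $q(\mathsf{E})=\mathsf{E}\otimes_{\mathsf{T}}q(\mathsf{T})$ over its center $q(\mathsf{T})$, the field of fractions of $\mathsf{T}$. Likewise, for a division ring $D$ finite-dimensional over its center, with an involution $\rho$, define $$\mathrm{SK}_1(D,\rho)=\{a\in D^*\mid \mathrm{Nrd}_{D}(a\,\rho(a)^{-1})=1\}\,\big/\,\langle a\in D^*\mid\rho(a)=a\rangle.$$ Suppose that $\mathsf{E}$ is unramified over $\mathsf{R}$, that is, $\mathsf{E}$ is inertial over $\mathsf{T}$ ($\Gamma_{\mathsf{E}}=\Gamma_{\mathsf{T}}$) and $\mathsf{T}$ is unramified over $\mathsf{R}$ ($\Gamma_{\mathsf{T}}=\Gamma_{\mathsf{R}}$). Then $$\mathrm{SK}_1(\mathsf{E},\tau)\;\cong\;\mathrm{SK}_1(\mathsf{E}_0,\tau|_{\mathsf{E}_0}).$$ -/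

import Mathlib

open scoped TensorProduct

namespace UnitarySK

/-! ### Involutions and the groups they define -/

section Involution

variable {A : Type*} [Ring A]

/-- The map induced on the group of units by an involution `τ`. -/
def unitsInvo (τ : RingInvo A) (a : Aˣ) : Aˣ where
  val := (τ (a : A)).unop
  inv := (τ ((a⁻¹ : Aˣ) : A)).unop
  val_inv := by rw [← MulOpposite.unop_mul, ← map_mul]; simp
  inv_val := by rw [← MulOpposite.unop_mul, ← map_mul]; simp

theorem unitsInvo_mul (τ : RingInvo A) (a b : Aˣ) :
    unitsInvo τ (a * b) = unitsInvo τ b * unitsInvo τ a := by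
  ext; simp [unitsInvo]

theorem unitsInvo_unitsInvo (τ : RingInvo A) (a : Aˣ) : unitsInvo τ (unitsInvo τ a) = a := by
  ext; exact τ.involution _

/-- `Σ_τ(A)`: the subgroup of `A^*` generated by the units `a` with `τ(a) = a`. -/
def sigma (τ : RingInvo A) : Subgroup Aˣ :=
  Subgroup.closure {a : Aˣ | unitsInvo τ a = a}

/-- For `a` symmetric, `b a b⁻¹ = (b a τ(b)) (b τ(b))⁻¹`, so `Σ_τ(A)` is normal in `A^*`. -/
instance sigma_normal (τ : RingInvo A) : (sigma τ).Normal := by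
  constructor
  intro x hx b
  induction hx using Subgroup.closure_induction with
  | mem a ha =>
    have h1 : b * a * unitsInvo τ b ∈ sigma τ := by
      apply Subgroup.subset_closure
      simp only [Set.mem_ofPred_eq] at ha ⊢
      rw [unitsInvo_mul, unitsInvo_mul, unitsInvo_unitsInvo, ha, mul_assoc]
    have h2 : b * unitsInvo τ b ∈ sigma τ := by
      apply Subgroup.subset_closure
      simp only [Set.mem_ofPred_eq]
      rw [unitsInvo_mul, unitsInvo_unitsInvo]
    have := (sigma τ).mul_mem h1 ((sigma τ).inv_mem h2)
    convert this using 1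
    group
  | one => simp
  | mul x y _ _ hx hy =>
    have := (sigma τ).mul_mem hx hy
    convert this using 1
    group
  | inv x _ hx =>
    have := (sigma τ).inv_mem hx
    convert this using 1
    group

/-- `Σ'_τ(A)` with respect to a multiplicative map `ν` into a commutative monoid (used below with
`ν` the reduced norm): the group of all units `a` with `ν(a τ(a)⁻¹) = 1`. -/
def sigmaPrime {M : Type*} [CommMonoid M] (τ : RingInvo A) (ν : A →* M) : Subgroup Aˣ where
  carrier := {a : Aˣ | Units.map ν (a * (unitsInvo τ a)⁻¹) = 1}
  one_mem' := by
    have h : unitsInvo τ (1 : Aˣ) = 1 := by ext; simp [unitsInvo]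
    simp [h]
  mul_mem' := by
    intro a b ha hb
    simp only [Set.mem_ofPred_eq, map_mul, map_inv, unitsInvo_mul, mul_inv_eq_one] at ha hb ⊢
    rw [ha, hb, mul_comm]
  inv_mem' := by
    intro a ha
    have h : unitsInvo τ a⁻¹ = (unitsInvo τ a)⁻¹ := by
      rw [eq_inv_iff_mul_eq_one, ← unitsInvo_mul]; ext; simp [unitsInvo]
    simp only [Set.mem_ofPred_eq, map_mul, map_inv, mul_inv_eq_one, h] at ha ⊢
    rw [ha]

end Involution

/-! ### The reduced norm of a central simple algebra -/

section ReducedNorm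

variable (K A : Type*) [Field K] [Ring A] [Algebra K A]

/-- The degree of a central simple `K`-algebra `A`: the number `n` with `n ^ 2 = [A : K]`. -/
noncomputable def degree : ℕ := Nat.sqrt (Module.finrank K A)

open Classical in
/-- The reduced norm of a central simple algebra `A` of degree `n` over a field `K`:
choose a `K`-algebra homomorphism `φ : A → M_n(L)`, where `L` is an algebraic closure of `K`
(equivalently, an isomorphism of `L ⊗ A` with `M_n(L)`), and put `Nrd(a) = det (φ a)`.
For a central simple algebra such a `φ` exists, and the value, which lies in `K`, does not depend
on `φ`. It is recorded here as an element of `L`.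
(The value `1` is used for algebras that have no such `φ`.) -/
noncomputable def reducedNorm : A →* AlgebraicClosure K :=
  if h : Nonempty (A →ₐ[K] Matrix (Fin (degree K A)) (Fin (degree K A)) (AlgebraicClosure K)) then
    (Matrix.detMonoidHom).comp
      (h.some : A →* Matrix (Fin (degree K A)) (Fin (degree K A)) (AlgebraicClosure K))
  else 1

end ReducedNorm

/-! ### Unitary `SK₁` of a division ring -/

/-- `SK₁(D, τ) = {a ∈ D^* | Nrd_D(a τ(a)⁻¹) = 1} / ⟨a ∈ D^* | τ(a) = a⟩`, for an involution `τ` on a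
division ring `D` that is finite dimensional over its center. -/
abbrev SK₁ (D : Type*) [DivisionRing D] (τ : RingInvo D) : Type _ :=
  sigmaPrime τ (reducedNorm (Subring.center D) D) ⧸
    (sigma τ).subgroupOf (sigmaPrime τ (reducedNorm (Subring.center D) D))

/-! ### Graded division rings -/

section Graded

variable {Γ E : Type*} [AddCommGroup Γ] [DecidableEq Γ] [Ring E]

/-- A graded ring, nonzero, all of whose nonzero homogeneous elements are invertible.
(The grade group is required to be torsion free separately.) -/
class GradedDivisionRing (𝒜 : Γ → AddSubgroup E) [GradedRing 𝒜] : Prop where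
  nontrivial : Nontrivial E
  isUnit : ∀ γ : Γ, ∀ a ∈ 𝒜 γ, a ≠ 0 → IsUnit a

/-- The grade set `Γ_S = {γ | S ∩ E_γ ≠ 0}` of a graded subring `S` of `E`. -/
def gradeSet (𝒜 : Γ → AddSubgroup E) (S : Subring E) : Set Γ :=
  {γ | ∃ a ∈ S, a ∈ 𝒜 γ ∧ a ≠ 0}

/-- `R = T^τ`: the subring of all elements of the center `T` of `E` that are fixed by `τ`. -/
def centerFixed (τ : RingInvo E) : Subring E where
  carrier := {t | t ∈ Subring.center E ∧ (τ t).unop = t}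
  mul_mem' := by
    rintro a b ⟨ha, ha'⟩ ⟨hb, hb'⟩
    refine ⟨mul_mem ha hb, ?_⟩
    rw [map_mul, MulOpposite.unop_mul, ha', hb']
    exact Subring.mem_center_iff.1 ha b
  one_mem' := ⟨one_mem _, by simp⟩
  add_mem' := by
    rintro a b ⟨ha, ha'⟩ ⟨hb, hb'⟩
    exact ⟨add_mem ha hb, by rw [map_add, MulOpposite.unop_add, ha', hb']⟩
  zero_mem' := ⟨zero_mem _, by simp⟩
  neg_mem' := by
    rintro a ⟨ha, ha'⟩
    exact ⟨neg_mem ha, by rw [map_neg, MulOpposite.unop_neg, ha']⟩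

/-- A graded involution: an involution that preserves every homogeneous component. -/
def IsGradedInvo (𝒜 : Γ → AddSubgroup E) (τ : RingInvo E) : Prop :=
  ∀ γ : Γ, ∀ a ∈ 𝒜 γ, (τ a).unop ∈ 𝒜 γ

/-- A unitary involution: an involution that is not the identity on the center. -/
def IsUnitary (τ : RingInvo E) : Prop :=
  ∃ t ∈ Subring.center E, (τ t).unop ≠ t

variable (𝒜 : Γ → AddSubgroup E) [GradedRing 𝒜]

/-- The restriction of a graded involution to the ring `E₀`. -/
def restrictZero (τ : RingInvo E) (hτ : IsGradedInvo 𝒜 τ) : RingInvo (𝒜 0) :=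
  RingInvo.mk'
    { toFun := fun a => MulOpposite.op ⟨(τ (a : E)).unop, hτ 0 a a.2⟩
      map_one' := by apply MulOpposite.unop_injective; ext; simp
      map_mul' := fun a b => by apply MulOpposite.unop_injective; ext; simp
      map_zero' := by apply MulOpposite.unop_injective; ext; simp
      map_add' := fun a b => by apply MulOpposite.unop_injective; ext; simp }
    (fun a => Subtype.ext (τ.involution (a : E)))

theorem restrictZero_apply (τ : RingInvo E) (hτ : IsGradedInvo 𝒜 τ) (a : 𝒜 0) :
    ((restrictZero 𝒜 τ hτ a).unop : E) = (τ (a : E)).unop := rfl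

variable [GradedDivisionRing 𝒜]

theorem exists_inv_zero (a : 𝒜 0) (ha : a ≠ 0) : ∃ b : 𝒜 0, a * b = 1 := by
  obtain ⟨u, hu⟩ := GradedDivisionRing.isUnit (𝒜 := 𝒜) 0 (a : E) a.2
    (fun h => ha (Subtype.ext h))
  refine ⟨DirectSum.decompose 𝒜 ((u⁻¹ : Eˣ) : E) 0, Subtype.ext ?_⟩
  have h := DirectSum.coe_decompose_mul_of_left_mem_zero 𝒜 (j := (0 : Γ)) (a := (a : E))
    (b := ((u⁻¹ : Eˣ) : E)) a.2
  rw [← hu, Units.mul_inv, hu] at h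
  rw [SetLike.GradeZero.coe_mul, ← h, SetLike.GradeZero.coe_one]
  exact DirectSum.decompose_of_mem_same 𝒜 (SetLike.GradedOne.one_mem)

open Classical in
/-- The degree-zero component `E₀` of a graded division ring is a division ring. -/
noncomputable instance divisionRingZero : DivisionRing (𝒜 0) :=
  { (inferInstance : Ring (𝒜 0)) with
    inv := fun a => if ha : a = 0 then 0 else (exists_inv_zero 𝒜 a ha).choose
    exists_pair_ne := by
      have := GradedDivisionRing.nontrivial (𝒜 := 𝒜)
      exact ⟨0, 1, fun h => zero_ne_one (α := E) (congrArg Subtype.val h)⟩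
    mul_inv_cancel := by
      intro a ha
      change a * (if ha : a = 0 then 0 else (exists_inv_zero 𝒜 a ha).choose) = 1
      rw [dif_neg ha]
      exact (exists_inv_zero 𝒜 a ha).choose_spec
    inv_zero := by
      change (if ha : (0 : 𝒜 0) = 0 then 0 else (exists_inv_zero 𝒜 0 ha).choose) = 0
      simp
    nnqsmul := _
    qsmul := _ }

end Graded

/-- A graded division ring with torsion-free grade group has no zero divisors. -/
theorem noZeroDivisors {Γ E : Type*} [AddCommGroup Γ] [DecidableEq Γ] [Ring E]
    (𝒜 : Γ → AddSubgroup E) [GradedRing 𝒜] [GradedDivisionRing 𝒜] [IsAddTorsionFree Γ] :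
    NoZeroDivisors E := by
  classical
  have hnt := GradedDivisionRing.nontrivial (𝒜 := 𝒜)
  refine ⟨fun {a b} hab => ?_⟩
  by_contra! hne
  obtain ⟨ha, hb⟩ := hne
  have hsupp : ∀ x : E, x ≠ 0 → (DirectSum.decompose 𝒜 x).support.Nonempty := by
    intro x hx
    rw [Finset.nonempty_iff_ne_empty, Ne, DFinsupp.support_eq_empty]
    exact fun h => hx ((DirectSum.decompose 𝒜).injective (by rw [h, DirectSum.decompose_zero]))
  set S := (DirectSum.decompose 𝒜 a).support with hS
  set T := (DirectSum.decompose 𝒜 b).support with hT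
  -- the supports lie in a finitely generated torsion-free group, which has unique sums
  let G : AddSubgroup Γ := AddSubgroup.closure ((S ∪ T : Finset Γ) : Set Γ)
  have hSG : ∀ x ∈ S, x ∈ G := fun x hx => AddSubgroup.subset_closure (by simp [hx])
  have hTG : ∀ x ∈ T, x ∈ G := fun x hx => AddSubgroup.subset_closure (by simp [hx])
  have : AddGroup.FG G := AddGroup.closure_finset_fg _
  have : AddMonoid.FG G := AddGroup.fg_iff_addMonoid_fg.1 this
  have : IsAddTorsionFree G :=
    Function.Injective.isAddTorsionFree G.subtype Subtype.val_injective
  obtain ⟨s, hs, t, ht, hst⟩ := UniqueSums.uniqueAdd_of_nonempty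
    (A := S.subtype (· ∈ G)) (B := T.subtype (· ∈ G))
    (by obtain ⟨x, hx⟩ := hsupp a ha; exact ⟨⟨x, hSG x hx⟩, Finset.mem_subtype.2 hx⟩)
    (by obtain ⟨x, hx⟩ := hsupp b hb; exact ⟨⟨x, hTG x hx⟩, Finset.mem_subtype.2 hx⟩)
  rw [Finset.mem_subtype] at hs ht
  have key : (DirectSum.decompose 𝒜 (a * b) ((s : Γ) + t) : E) =
      DirectSum.decompose 𝒜 a s * DirectSum.decompose 𝒜 b t := by
    rw [DirectSum.decompose_mul, DirectSum.coe_mul_apply]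
    rw [Finset.sum_eq_single ((s : Γ), (t : Γ))]
    · rintro ⟨x, y⟩ hxy hne
      simp only [Finset.mem_filter, Finset.mem_product] at hxy
      obtain ⟨⟨hx, hy⟩, hadd⟩ := hxy
      have := hst (a := ⟨x, hSG x hx⟩) (b := ⟨y, hTG y hy⟩) (Finset.mem_subtype.2 hx)
        (Finset.mem_subtype.2 hy)
        (Subtype.ext hadd)
      exact absurd (Prod.ext (congrArg Subtype.val this.1) (congrArg Subtype.val this.2)) hne
    · intro h
      refine absurd ?_ h
      exact Finset.mem_filter.2 ⟨Finset.mem_product.2 ⟨hs, ht⟩, rfl⟩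
  rw [hab] at key
  have hu := GradedDivisionRing.isUnit (𝒜 := 𝒜) s _ (DirectSum.decompose 𝒜 a s).2
    (by simpa using DFinsupp.mem_support_iff.1 hs)
  have hv := GradedDivisionRing.isUnit (𝒜 := 𝒜) t _ (DirectSum.decompose 𝒜 b t).2
    (by simpa using DFinsupp.mem_support_iff.1 ht)
  have := (hu.mul hv).ne_zero
  rw [← key] at this
  simp at this

/-- The center of a graded division ring with torsion-free grade group is an integral domain. -/
theorem isDomain_center {Γ E : Type*} [AddCommGroup Γ] [DecidableEq Γ] [Ring E]
    (𝒜 : Γ → AddSubgroup E) [GradedRing 𝒜] [GradedDivisionRing 𝒜] [IsAddTorsionFree Γ] :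
    IsDomain (Subring.center E) := by
  have := GradedDivisionRing.nontrivial (𝒜 := 𝒜)
  have := noZeroDivisors 𝒜
  have : IsDomain E := NoZeroDivisors.to_isDomain E
  exact Function.Injective.isDomain (Subring.center E).subtype Subtype.val_injective

/-! ### Unitary `SK₁` of a graded division ring -/

/-- The reduced norm of a graded division ring `E` with center `T`: the reduced norm of the
quotient division ring `q(E) = q(T) ⊗_T E`, a central simple algebra over the field of fractions
`q(T)` of `T`, evaluated on elements of `E`. -/
noncomputable def gradedReducedNorm (E : Type*) [Ring E] [IsDomain (Subring.center E)] :
    E →* AlgebraicClosure (FractionRing (Subring.center E)) :=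
  (reducedNorm (FractionRing (Subring.center E))
      (FractionRing (Subring.center E) ⊗[Subring.center E] E)).comp
    (Algebra.TensorProduct.includeRight :
      E →ₐ[Subring.center E] FractionRing (Subring.center E) ⊗[Subring.center E] E)

section GradedSK

variable {Γ E : Type*} [AddCommGroup Γ] [DecidableEq Γ] [Ring E]
  (𝒜 : Γ → AddSubgroup E) [GradedRing 𝒜] [GradedDivisionRing 𝒜] [IsAddTorsionFree Γ]

/-- `Σ'_τ(E) = {a ∈ E^* | Nrd_E(a τ(a)⁻¹) = 1}` for a graded division ring `E`. -/
noncomputable def gradedSigmaPrime (τ : RingInvo E) : Subgroup Eˣ :=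
  haveI := isDomain_center 𝒜
  sigmaPrime τ (gradedReducedNorm E)

/-- `SK₁(E, τ) = {a ∈ E^* | Nrd_E(a τ(a)⁻¹) = 1} / ⟨a ∈ E^* | τ(a) = a⟩`, for a graded
involution `τ` on a graded division ring `E` that is finite dimensional over its center. -/
abbrev GradedSK₁ (τ : RingInvo E) : Type _ :=
  gradedSigmaPrime 𝒜 τ ⧸ (sigma τ).subgroupOf (gradedSigmaPrime 𝒜 τ)

end GradedSK

end UnitarySK

/-! Write T for the center of E and R for its symmetric elements. Since E is unramified over R,
every degree occurring in E contains a nonzero homogeneous r in R, and r is a unit. A torsion-free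
grade group forces all units of E to be homogeneous (`exists_mem_of_units`), so every unit is a
product b r with b a unit of E₀ and r a central symmetric unit.

Such an r lies in both Σ' and Σ, so it disappears in the quotient, and the inclusion of E₀ induces a
surjection onto SK₁ of E. Injectivity holds because symmetric generators of E have symmetric
E₀-factors (`mem_sigma_of_map_mem`).

It remains to compare the norm conditions (`exists_gradedReducedNorm_eq`). E₀ and T generate E, so
Z(E₀) is contained in T and q(E) is the scalar extension of E₀ from Z(E₀) to q(T): the natural map
from this extension is onto, and it is injective because its source is simple
(`isSimpleRing_tensorProduct`). Hence the degrees agree, and so do the reduced norms, since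
determinants do not depend on the chosen matrix representation (`det_algHom_matrix`). -/

namespace UnitarySK

/-! ### Central division algebras split over an algebraically closed field -/

section Splitting

/-- A field extension `L` of `F` tensored with a central division algebra over `F` is simple. -/
theorem isSimpleRing_tensorProduct (F L D : Type*) [Field F] [Field L] [Algebra F L]
    [DivisionRing D] [Algebra F D] [Algebra.IsCentral F D] : IsSimpleRing (L ⊗[F] D) := by
  classical
  -- An `F`-basis of `L` gives coordinates in `D`, on which `1 ⊗ d` acts by left and right
  -- multiplication.
  let b := Module.Basis.ofVectorSpace F L
  let e := TensorProduct.equivFinsuppOfBasisLeft (N := D) b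
  have he : ∀ (l : L) (d : D) i, e (l ⊗ₜ d) i = b.repr l i • d := fun l d i =>
    TensorProduct.equivFinsuppOfBasisLeft_apply_tmul_apply b l d i
  have hel : ∀ (d : D) (x : L ⊗[F] D) i, e ((1 ⊗ₜ d) * x) i = d * e x i := by
    intro d x i
    induction x with
    | zero => simp
    | tmul l d' => simp [he]
    | add x y hx hy => simp [mul_add, hx, hy]
  have her : ∀ (d : D) (x : L ⊗[F] D) i, e (x * (1 ⊗ₜ d)) i = e x i * d := by
    intro d x i
    induction x with
    | zero => simp
    | tmul l d' => simp [he]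
    | add x y hx hy => simp [add_mul, hx, hy]
  refine .of_eq_bot_or_eq_top fun I => ?_
  -- Shortest-element argument: induction on the number of nonzero coordinates of an element of the
  -- ideal.
  suffices H : ∀ (n : ℕ) (x : L ⊗[F] D), (e x).support.card ≤ n → x ≠ 0 → x ∈ I → 1 ∈ I by
    rw [or_iff_not_imp_left, ← I.one_mem_iff]
    intro hI
    obtain ⟨x, hx, hx0⟩ := SetLike.exists_of_lt (bot_lt_iff_ne_bot.mpr hI : ⊥ < I)
    exact H _ x le_rfl hx0 hx
  intro n
  induction n with
  | zero =>
    intro x hx hx0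
    rw [Nat.le_zero, Finset.card_eq_zero, Finsupp.support_eq_empty] at hx
    exact absurd (e.map_eq_zero_iff.1 hx) hx0
  | succ n ih =>
    intro x hx hx0 hxI
    obtain ⟨i, hi⟩ : (e x).support.Nonempty := by
      rw [Finset.nonempty_iff_ne_empty, Ne, Finsupp.support_eq_empty]
      exact fun h => hx0 (e.map_eq_zero_iff.1 h)
    have hi' : e x i ≠ 0 := Finsupp.mem_support_iff.1 hi
    set y : L ⊗[F] D := (1 ⊗ₜ (e x i)⁻¹) * x with hy
    have hyI : y ∈ I := I.mul_mem_left _ _ hxI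
    have hyi : e y i = 1 := by rw [hy, hel, inv_mul_cancel₀ hi']
    -- If `y` commutes with `1 ⊗ D`, its coordinates are central, so `y = l ⊗ 1` is invertible.
    -- Otherwise a nonzero commutator lies in `I` and is shorter: its `i`-th coordinate vanishes, as
    -- that of `y` is `1`.
    by_cases hc : ∀ d : D, (1 ⊗ₜ d) * y - y * (1 ⊗ₜ d) = 0
    · have hcen : ∀ j, ∃ c : F, e y j = algebraMap F D c := fun j => by
        rw [← Algebra.IsCentral.mem_center_iff (K := F), Subalgebra.mem_center_iff]
        intro d
        have := congrArg (fun z => e z j) (sub_eq_zero.1 (hc d))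
        simpa [hel, her] using this
      choose c hc using hcen
      have hsum : y = ((e y).sum fun j _ => c j • b j) ⊗ₜ 1 := by
        conv_lhs => rw [← e.symm_apply_apply y,
          TensorProduct.equivFinsuppOfBasisLeft_symm_apply]
        rw [Finsupp.sum, Finsupp.sum, TensorProduct.sum_tmul]
        refine Finset.sum_congr rfl fun j _ => ?_
        rw [hc j, Algebra.algebraMap_eq_smul_one, TensorProduct.smul_tmul]
      set l : L := (e y).sum fun j _ => c j • b j
      have hl : l ≠ 0 := by
        intro h
        rw [h, TensorProduct.zero_tmul] at hsum
        rw [hsum] at hyi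
        simp at hyi
      have : (l⁻¹ ⊗ₜ 1) * y ∈ I := I.mul_mem_left _ _ hyI
      rwa [hsum, Algebra.TensorProduct.tmul_mul_tmul, inv_mul_cancel₀ hl, one_mul,
        ← Algebra.TensorProduct.one_def] at this
    · push Not at hc
      obtain ⟨d, hd⟩ := hc
      refine ih _ ?_ hd (I.sub_mem (I.mul_mem_left _ _ hyI) (I.mul_mem_right _ _ hyI))
      have hsub : (e ((1 ⊗ₜ d) * y - y * (1 ⊗ₜ d))).support ⊆ (e x).support.erase i := by
        intro j hj
        rw [Finsupp.mem_support_iff, map_sub, Finsupp.sub_apply, hel, her] at hj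
        rw [Finset.mem_erase, Finsupp.mem_support_iff]
        refine ⟨?_, fun h => hj ?_⟩
        · rintro rfl
          simp [hyi] at hj
        · rw [hy, hel, h]
          simp
      have := Finset.card_le_card hsub
      rw [Finset.card_erase_of_mem hi] at this
      omega

variable (F L D : Type*) [Field F] [Field L] [Algebra F L] [DivisionRing D] [Algebra F D]
  [Algebra.IsCentral F D] [FiniteDimensional F D]

/-- A finite dimensional central division algebra has square dimension, and it embeds into the
matrices of the expected size over every algebraically closed extension of its center. -/
theorem exists_algHom_matrix [IsAlgClosed L] :
    degree F D * degree F D = Module.finrank F D ∧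
      Nonempty (D →ₐ[F] Matrix (Fin (degree F D)) (Fin (degree F D)) L) := by
  have := isSimpleRing_tensorProduct F L D
  obtain ⟨n, -, ⟨e⟩⟩ := IsSimpleRing.exists_algEquiv_matrix_of_isAlgClosed L (L ⊗[F] D)
  have h : n * n = Module.finrank F D := by
    rw [← Module.finrank_baseChange (R := L) (M' := D), e.toLinearEquiv.finrank_eq,
      Module.finrank_matrix]
    simp
  have hn : degree F D = n := by rw [degree, ← h, Nat.sqrt_eq]
  rw [hn]
  exact ⟨h, ⟨(e.toAlgHom.restrictScalars F).comp Algebra.TensorProduct.includeRight⟩⟩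

variable {F L D}

/-- An automorphism of a matrix algebra over a field preserves determinants. -/
theorem det_algEquiv {n : ℕ} (f : Matrix (Fin n) (Fin n) L ≃ₐ[L] Matrix (Fin n) (Fin n) L)
    (M : Matrix (Fin n) (Fin n) L) : (f M).det = M.det := by
  -- Skolem–Noether: transported to endomorphisms of `L ^ n`, the automorphism is conjugation by
  -- some `T`.
  obtain ⟨T, hT⟩ := AlgEquiv.eq_linearEquivConjAlgEquiv
    ((Matrix.toLinAlgEquiv'.symm.trans f).trans Matrix.toLinAlgEquiv')
  have h := DFunLike.congr_fun hT (Matrix.toLinAlgEquiv' M)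
  simp only [AlgEquiv.trans_apply, AlgEquiv.symm_apply_apply] at h
  rw [← LinearMap.det_toLin' (f M), ← LinearMap.det_toLin' M]
  change LinearMap.det (Matrix.toLinAlgEquiv' (f M)) = LinearMap.det (Matrix.toLinAlgEquiv' M)
  rw [h, LinearEquiv.conjAlgEquiv_apply]
  exact LinearMap.det_conj _ T

/-- The determinant of a matrix representation of degree `n` of a central division algebra of
dimension `n ^ 2` does not depend on the representation. -/
theorem det_algHom_matrix {n : ℕ} (hn : n * n = Module.finrank F D)
    (φ ψ : D →ₐ[F] Matrix (Fin n) (Fin n) L) (a : D) : (φ a).det = (ψ a).det := by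
  have := isSimpleRing_tensorProduct F L D
  have hn0 : n ≠ 0 := by
    rintro rfl
    exact Module.finrank_pos.ne hn
  have : NeZero n := ⟨hn0⟩
  let lift (χ : D →ₐ[F] Matrix (Fin n) (Fin n) L) : L ⊗[F] D →ₐ[L] Matrix (Fin n) (Fin n) L :=
    Algebra.TensorProduct.lift (Algebra.ofId L _) χ fun l d => by
      rw [Algebra.ofId_apply]; exact Algebra.commute_algebraMap_left l (χ d)
  have hlift : ∀ χ d, lift χ (1 ⊗ₜ d) = χ d := fun χ d => by simp [lift]
  -- Simplicity of the source gives injectivity, and both sides have dimension `n * n` over `L`.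
  -- Thus two representations differ by an automorphism of the matrix algebra.
  have hbij : ∀ χ, Function.Bijective (lift χ) := fun χ => by
    have hinj : Function.Injective (lift χ).toLinearMap :=
      RingHom.injective (lift χ : L ⊗[F] D →+* Matrix (Fin n) (Fin n) L)
    refine ⟨hinj, (LinearMap.injective_iff_surjective_of_finrank_eq_finrank ?_).1 hinj⟩
    rw [Module.finrank_baseChange, Module.finrank_matrix]
    simp [← hn]
  let f := (AlgEquiv.ofBijective _ (hbij φ)).symm.trans (AlgEquiv.ofBijective _ (hbij ψ))
  have hf : f (φ a) = ψ a := by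
    have h : (AlgEquiv.ofBijective _ (hbij φ)).symm (lift φ (1 ⊗ₜ a)) = 1 ⊗ₜ a := by
      rw [AlgEquiv.symm_apply_eq, AlgEquiv.ofBijective_apply]
    rw [← hlift φ a, ← hlift ψ a, AlgEquiv.trans_apply, h, AlgEquiv.ofBijective_apply]
  rw [← hf, det_algEquiv]

end Splitting

/-! ### The reduced norm under scalar extension -/

section ScalarExtension

/-- The reduced norm of a finite dimensional central division algebra is computed by any
representation of degree equal to its own. -/
theorem reducedNorm_eq_det {F D L : Type*} [Field F] [DivisionRing D] [Algebra F D]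
    [Algebra.IsCentral F D] [FiniteDimensional F D] [Field L] [Algebra F L]
    (ι : AlgebraicClosure F →ₐ[F] L)
    (ψ : D →ₐ[F] Matrix (Fin (degree F D)) (Fin (degree F D)) L) (a : D) :
    ι (reducedNorm F D a) = (ψ a).det := by
  obtain ⟨hn, hφ⟩ := exists_algHom_matrix F (AlgebraicClosure F) D
  rw [reducedNorm, dif_pos hφ]
  change ι (Matrix.det (hφ.some a)) = _
  rw [AlgHom.map_det]
  exact det_algHom_matrix hn (ι.mapMatrix.comp hφ.some) ψ a

/-- If `A` is generated over its scalars `K` by a central division algebra `D` over a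
subfield `F` of `K`, then the reduced norms of `A` and `D` agree on `D`. -/
theorem exists_reducedNorm_eq {F D K A : Type*} [Field F] [DivisionRing D] [Algebra F D]
    [Algebra.IsCentral F D] [Field K] [Algebra F K] [Ring A] [Nontrivial A] [Algebra K A]
    [Algebra F A] [IsScalarTower F K A] [FiniteDimensional K A]
    (j : D →ₐ[F] A) (hj : Submodule.span K (Set.range j) = ⊤) :
    ∃ ι : AlgebraicClosure F →+* AlgebraicClosure K,
      ∀ d, reducedNorm K A (j d) = ι (reducedNorm F D d) := by
  have := isSimpleRing_tensorProduct F K D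
  let Φ : K ⊗[F] D →ₐ[K] A :=
    Algebra.TensorProduct.lift (Algebra.ofId K A) j fun l d => by
      rw [Algebra.ofId_apply]; exact Algebra.commute_algebraMap_left l (j d)
  have hΦ : ∀ d, Φ (1 ⊗ₜ d) = j d := fun d => by simp [Φ]
  have hinj : Function.Injective Φ := RingHom.injective (Φ : K ⊗[F] D →+* A)
  have hsurj : Function.Surjective Φ := by
    rw [← AlgHom.coe_toLinearMap, ← LinearMap.range_eq_top, eq_top_iff, ← hj, Submodule.span_le]
    rintro _ ⟨d, rfl⟩
    exact ⟨1 ⊗ₜ d, hΦ d⟩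
  let e := AlgEquiv.ofBijective Φ ⟨hinj, hsurj⟩
  -- Finiteness is known only over `K`; it descends to `D` over `F` by faithful flatness.
  have hfin : Module.Finite K (K ⊗[F] D) := Module.Finite.equiv e.symm.toLinearEquiv
  have : FiniteDimensional F D := Module.Finite.of_finite_tensorProduct_of_faithfullyFlat K
  have hdeg : degree K A = degree F D := by
    rw [degree, degree, ← e.toLinearEquiv.finrank_eq, Module.finrank_baseChange]
  let ι : AlgebraicClosure F →ₐ[F] AlgebraicClosure K := IsAlgClosed.lift
  obtain ⟨-, ⟨ψ⟩⟩ := exists_algHom_matrix F (AlgebraicClosure K) D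
  -- A representation of `A` of the right degree exists, so `reducedNorm` does not take its default
  -- value.
  have hne : Nonempty
      (A →ₐ[K] Matrix (Fin (degree K A)) (Fin (degree K A)) (AlgebraicClosure K)) := by
    rw [hdeg]
    exact ⟨(Algebra.TensorProduct.lift (Algebra.ofId K _) ψ
      fun l d => by
      rw [Algebra.ofId_apply]; exact Algebra.commute_algebraMap_left l (ψ d)).comp e.symm.toAlgHom⟩
  refine ⟨ι, fun d => ?_⟩
  rw [reducedNorm, dif_pos hne]
  -- The representation is made arbitrary so that `hdeg` can rewrite its size.
  generalize hne.some = χ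
  change (χ (j d)).det = ι (reducedNorm F D d)
  revert χ
  rw [hdeg]
  intro χ
  exact (reducedNorm_eq_det ι ((χ.restrictScalars F).comp j) d).symm

end ScalarExtension

/-! ### Comparison of the groups of two rings with involution -/

section Comparison

variable {D E : Type*} [Ring D] [Ring E] {f : D →+* E} {σ : RingInvo D} {τ : RingInvo E}

theorem map_unitsInvo (hτ : ∀ a, (τ (f a)).unop = f (σ a).unop) (a : Dˣ) :
    unitsInvo τ (Units.map f a) = Units.map f (unitsInvo σ a) :=
  Units.ext (hτ a)

theorem map_mem_sigma (hτ : ∀ a, (τ (f a)).unop = f (σ a).unop) {a : Dˣ} (ha : a ∈ sigma σ) :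
    Units.map (f : D →* E) a ∈ sigma τ := by
  suffices sigma σ ≤ (sigma τ).comap (Units.map (f : D →* E)) from this ha
  rw [sigma, Subgroup.closure_le]
  intro a ha
  exact Subgroup.subset_closure ((map_unitsInvo hτ a).trans (congrArg _ ha))

theorem unitsInvo_mul_of_central {r : Eˣ} (hr : (r : E) ∈ Subring.center E)
    (hrτ : unitsInvo τ r = r) (u : Eˣ) : unitsInvo τ (u * r) = unitsInvo τ u * r := by
  rw [unitsInvo_mul, hrτ]
  exact Units.ext (Subring.mem_center_iff.1 hr _).symm

/-- If every unit of `E` is the product of a unit of `D` and a central symmetric unit, then the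
symmetric units of `E` generate no more elements of `D` than those of `D`. -/
theorem mem_sigma_of_map_mem (hf : Function.Injective f)
    (hτ : ∀ a, (τ (f a)).unop = f (σ a).unop)
    (hE : ∀ u : Eˣ, ∃ (a : Dˣ) (r : Eˣ), (r : E) ∈ Subring.center E ∧ unitsInvo τ r = r ∧
      u = Units.map (f : D →* E) a * r) {a : Dˣ}
    (ha : Units.map (f : D →* E) a ∈ sigma τ) : a ∈ sigma σ := by
  have hinj : Function.Injective (Units.map (f : D →* E)) := Units.map_injective hf
  -- Products of this shape form a group, since `r` is central. It contains the generators: if `b *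
  -- r` is symmetric, cancelling `r` shows that `b` is.
  have key : ∀ u ∈ sigma τ, ∃ s ∈ sigma σ, ∃ r : Eˣ, (r : E) ∈ Subring.center E ∧
      unitsInvo τ r = r ∧ u = Units.map (f : D →* E) s * r := by
    intro u hu
    have hcomm : ∀ {r : Eˣ}, (r : E) ∈ Subring.center E → ∀ v : Eˣ, v * r = r * v :=
      fun hr v => Units.ext (Subring.mem_center_iff.1 hr v)
    have hone : unitsInvo τ (1 : Eˣ) = 1 := by ext; simp [unitsInvo]
    induction hu using Subgroup.closure_induction with
    | mem u hu =>
      obtain ⟨b, r, hr, hrτ, rfl⟩ := hE u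
      refine ⟨b, Subgroup.subset_closure ?_, r, hr, hrτ, rfl⟩
      rw [Set.mem_ofPred_eq, unitsInvo_mul_of_central hr hrτ, map_unitsInvo hτ] at hu
      exact hinj (mul_right_cancel hu)
    | one => exact ⟨1, one_mem _, 1, one_mem _, hone, by simp⟩
    | mul x y _ _ hx hy =>
      obtain ⟨s, hs, r, hr, hrτ, rfl⟩ := hx
      obtain ⟨s', hs', r', hr', hrτ', rfl⟩ := hy
      refine ⟨s * s', mul_mem hs hs', r * r', mul_mem hr hr', ?_, ?_⟩
      · rw [unitsInvo_mul_of_central hr' hrτ', hrτ]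
      · rw [map_mul, mul_assoc, ← mul_assoc r, ← hcomm hr]
        simp only [mul_assoc]
    | inv x _ hx =>
      obtain ⟨s, hs, r, hr, hrτ, rfl⟩ := hx
      refine ⟨s⁻¹, inv_mem hs, r⁻¹, ?_, ?_, ?_⟩
      · rw [Subring.mem_center_iff]
        intro v
        have h := Subring.mem_center_iff.1 hr v
        rw [← Units.mul_left_inj r, ← Units.mul_right_inj r]
        simp only [mul_assoc, Units.inv_mul, mul_one, Units.mul_inv_cancel_left]
        exact h.symm
      · rw [eq_inv_iff_mul_eq_one]
        conv_lhs => rw [← hrτ]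
        rw [hrτ, ← unitsInvo_mul_of_central hr hrτ, inv_mul_cancel, hone]
      · rw [map_inv, hcomm hr, mul_inv_rev]
  obtain ⟨s, hs, r, hr, hrτ, h⟩ := key _ ha
  -- The leftover central factor itself comes from `D`, where it is symmetric.
  have hr' : r = Units.map (f : D →* E) (s⁻¹ * a) := by
    rw [map_mul, map_inv, h, inv_mul_cancel_left]
  have : s⁻¹ * a ∈ sigma σ := by
    refine Subgroup.subset_closure (hinj ?_)
    rw [← map_unitsInvo hτ, ← hr', hrτ]
  simpa using mul_mem hs this

/-- The isomorphism is the inverse of the map induced by `f`. That map is injective by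
`mem_sigma_of_map_mem`, and surjective because the factor `r` is a symmetric unit, hence trivial in
the quotient. -/
theorem nonempty_sigmaPrime_quotient_mulEquiv {M N : Type*} [CommMonoid M] [CommMonoid N]
    (ν : D →* M) (μ : E →* N) (ι : M →* N) (hι : Function.Injective ι)
    (hν : ∀ a, μ (f a) = ι (ν a)) (hf : Function.Injective f)
    (hτ : ∀ a, (τ (f a)).unop = f (σ a).unop)
    (hE : ∀ u : Eˣ, ∃ (a : Dˣ) (r : Eˣ), (r : E) ∈ Subring.center E ∧ unitsInvo τ r = r ∧
      u = Units.map (f : D →* E) a * r) :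
    Nonempty (sigmaPrime τ μ ⧸ (sigma τ).subgroupOf (sigmaPrime τ μ) ≃*
      sigmaPrime σ ν ⧸ (sigma σ).subgroupOf (sigmaPrime σ ν)) := by
  have hP : ∀ a : Dˣ, Units.map (f : D →* E) a ∈ sigmaPrime τ μ ↔ a ∈ sigmaPrime σ ν := by
    intro a
    change Units.map μ (_ * (unitsInvo τ (Units.map (f : D →* E) a))⁻¹) = 1 ↔
      Units.map ν (a * (unitsInvo σ a)⁻¹) = 1
    rw [map_unitsInvo hτ, ← map_inv, ← map_mul, ← (Units.map_injective hι).eq_iff, map_one]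
    refine Eq.congr_left (Units.ext ?_)
    exact hν _
  let g : sigmaPrime σ ν →* sigmaPrime τ μ :=
    ((Units.map (f : D →* E)).comp (sigmaPrime σ ν).subtype).codRestrict _
      fun a => (hP a).2 a.2
  have hg : (sigma σ).subgroupOf (sigmaPrime σ ν) =
      ((sigma τ).subgroupOf (sigmaPrime τ μ)).comap g := by
    ext a
    exact ⟨map_mem_sigma hτ, mem_sigma_of_map_mem hf hτ hE⟩
  let G := QuotientGroup.map _ _ g hg.le
  refine ⟨(MulEquiv.ofBijective G ⟨?_, ?_⟩).symm⟩
  · rw [injective_iff_map_eq_one]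
    intro x
    obtain ⟨a, rfl⟩ := QuotientGroup.mk_surjective x
    intro h
    rw [QuotientGroup.eq_one_iff, hg]
    exact (QuotientGroup.eq_one_iff (g a)).1 h
  · intro x
    obtain ⟨⟨u, hu⟩, rfl⟩ := QuotientGroup.mk_surjective x
    obtain ⟨a, r, hr, hrτ, rfl⟩ := hE u
    have hrσ : r ∈ sigma τ := Subgroup.subset_closure hrτ
    have ha : a ∈ sigmaPrime σ ν := by
      rw [← hP]
      have hrP : r ∈ sigmaPrime τ μ := by
        change Units.map μ (r * (unitsInvo τ r)⁻¹) = 1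
        rw [hrτ, mul_inv_cancel, map_one]
      exact (mul_mem_cancel_right hrP).1 hu
    refine ⟨QuotientGroup.mk ⟨a, ha⟩, ?_⟩
    refine QuotientGroup.eq.2 ?_
    rw [Subgroup.mem_subgroupOf]
    change (Units.map (f : D →* E) a)⁻¹ * (Units.map (f : D →* E) a * r) ∈ sigma τ
    rwa [inv_mul_cancel_left]

end Comparison

/-! ### Graded division rings with torsion-free grade group -/

/-- A torsion-free abelian group has the two unique sums property. -/
theorem twoUniqueSums_of_isAddTorsionFree (Γ : Type*) [AddCommGroup Γ] [IsAddTorsionFree Γ] :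
    TwoUniqueSums Γ := by
  classical
  refine ⟨fun {A B} hAB => ?_⟩
  let G : AddSubgroup Γ := AddSubgroup.closure ((A ∪ B : Finset Γ) : Set Γ)
  have hA : ∀ x ∈ A, x ∈ G := fun x hx => AddSubgroup.subset_closure (by simp [hx])
  have hB : ∀ x ∈ B, x ∈ G := fun x hx => AddSubgroup.subset_closure (by simp [hx])
  have : AddGroup.FG G := AddGroup.closure_finset_fg _
  have : AddMonoid.FG G := AddGroup.fg_iff_addMonoid_fg.1 this
  have : IsAddTorsionFree G :=
    Function.Injective.isAddTorsionFree G.subtype Subtype.val_injective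
  -- The property holds for finitely generated torsion-free groups; unique sums in `G` remain unique
  -- in `Γ`.
  have : TwoUniqueSums G := inferInstance
  have hA' : (A.subtype (· ∈ G)).map (Function.Embedding.subtype _) = A :=
    Finset.subtype_map_of_mem hA
  have hB' : (B.subtype (· ∈ G)).map (Function.Embedding.subtype _) = B :=
    Finset.subtype_map_of_mem hB
  obtain ⟨p, hp, q, hq, hpq, hpU, hqU⟩ := TwoUniqueSums.uniqueAdd_of_one_lt_card
    (A := A.subtype (· ∈ G)) (B := B.subtype (· ∈ G))
    (by rwa [← Finset.card_map, hA', ← Finset.card_map (Function.Embedding.subtype _), hB'])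
  have hU := fun (a b : G) => UniqueAdd.addHom_map_iff (A := A.subtype (· ∈ G))
    (B := B.subtype (· ∈ G)) (a0 := a) (b0 := b) (Function.Embedding.subtype _) fun _ _ => rfl
  rw [← hU, hA', hB'] at hpU hqU
  simp only [Finset.mem_product, Finset.mem_subtype] at hp hq
  refine ⟨(p.1, p.2), Finset.mem_product.2 hp, (q.1, q.2), Finset.mem_product.2 hq, ?_, hpU, hqU⟩
  intro h
  exact hpq (Prod.ext (Subtype.ext (congrArg Prod.fst h)) (Subtype.ext (congrArg Prod.snd h)))

section GradedDivision

variable {Γ E : Type*} [AddCommGroup Γ] [DecidableEq Γ] [Ring E]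
  (𝒜 : Γ → AddSubgroup E) [GradedRing 𝒜]

/-- A component of a product indexed by a uniquely represented sum of degrees. -/
theorem coe_decompose_mul_of_uniqueAdd [∀ (i : Γ) (x : 𝒜 i), Decidable (x ≠ 0)] {a b : E} {s t : Γ}
    (h : UniqueAdd (DirectSum.decompose 𝒜 a).support (DirectSum.decompose 𝒜 b).support s t)
    (hs : s ∈ (DirectSum.decompose 𝒜 a).support) (ht : t ∈ (DirectSum.decompose 𝒜 b).support) :
    (DirectSum.decompose 𝒜 (a * b) (s + t) : E) =
      DirectSum.decompose 𝒜 a s * DirectSum.decompose 𝒜 b t := by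
  rw [DirectSum.decompose_mul, DirectSum.coe_mul_apply, Finset.sum_eq_single (s, t)]
  · rintro ⟨x, y⟩ hxy hne
    simp only [Finset.mem_filter, Finset.mem_product] at hxy
    obtain ⟨rfl, rfl⟩ := h hxy.1.1 hxy.1.2 hxy.2
    exact absurd rfl hne
  · intro hst
    refine absurd ?_ hst
    exact Finset.mem_filter.2 ⟨Finset.mem_product.2 ⟨hs, ht⟩, rfl⟩

/-- The inverse of a homogeneous unit is homogeneous. -/
theorem units_inv_mem {γ : Γ} {u : Eˣ} (hu : (u : E) ∈ 𝒜 γ) : ((u⁻¹ : Eˣ) : E) ∈ 𝒜 (-γ) := by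
  -- Comparing degree-zero parts of `u * u⁻¹ = 1` shows that the component of `u⁻¹` in degree `-γ`
  -- is already an inverse of `u`.
  have h := DirectSum.coe_decompose_mul_add_of_left_mem 𝒜 (j := -γ) (b := ((u⁻¹ : Eˣ) : E)) hu
  rw [Units.mul_inv, add_neg_cancel,
    DirectSum.decompose_of_mem_same 𝒜 (SetLike.GradedOne.one_mem)] at h
  rw [Units.inv_eq_of_mul_eq_one_right h.symm]
  exact SetLike.coe_mem _

/-- In a graded division ring with torsion-free grade group every unit is homogeneous. -/
theorem exists_mem_of_units [GradedDivisionRing 𝒜] [IsAddTorsionFree Γ] (u : Eˣ) :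
    ∃ γ, (u : E) ∈ 𝒜 γ := by
  classical
  have := twoUniqueSums_of_isAddTorsionFree Γ
  have hnt := GradedDivisionRing.nontrivial (𝒜 := 𝒜)
  have hsupp : ∀ x : E, x ≠ 0 → 0 < (DirectSum.decompose 𝒜 x).support.card := by
    intro x hx
    rw [Finset.card_pos, Finset.nonempty_iff_ne_empty, Ne, DFinsupp.support_eq_empty]
    exact fun h => hx ((DirectSum.decompose 𝒜).injective (by rw [h, DirectSum.decompose_zero]))
  have hunit : ∀ (x : E) (γ : Γ), γ ∈ (DirectSum.decompose 𝒜 x).support →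
      IsUnit (DirectSum.decompose 𝒜 x γ : E) := fun x γ h =>
    GradedDivisionRing.isUnit (𝒜 := 𝒜) γ _ (DirectSum.decompose 𝒜 x γ).2
      (by simpa using DFinsupp.mem_support_iff.1 h)
  -- At a uniquely represented degree the component of `u * u⁻¹` is a product of two units, hence
  -- nonzero; but `1` lives in degree zero.
  have hzero : ∀ p ∈ (DirectSum.decompose 𝒜 (u : E)).support ×ˢ
      (DirectSum.decompose 𝒜 ((u⁻¹ : Eˣ) : E)).support,
      UniqueAdd (DirectSum.decompose 𝒜 (u : E)).support
        (DirectSum.decompose 𝒜 ((u⁻¹ : Eˣ) : E)).support p.1 p.2 → p.1 + p.2 = 0 := by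
    intro p hp hU
    rw [Finset.mem_product] at hp
    by_contra h
    have key := coe_decompose_mul_of_uniqueAdd 𝒜 hU hp.1 hp.2
    rw [Units.mul_inv, DirectSum.decompose_of_mem_ne 𝒜 (SetLike.GradedOne.one_mem) (Ne.symm h)]
      at key
    exact ((hunit _ _ hp.1).mul (hunit _ _ hp.2)).ne_zero key.symm
  -- Two distinct uniquely represented sums would both equal zero, contradicting uniqueness.
  have hcard : (DirectSum.decompose 𝒜 (u : E)).support.card *
      (DirectSum.decompose 𝒜 ((u⁻¹ : Eˣ) : E)).support.card ≤ 1 := by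
    by_contra! h
    obtain ⟨p, hp, q, hq, hpq, hpU, hqU⟩ := TwoUniqueSums.uniqueAdd_of_one_lt_card h
    rw [Finset.mem_product] at hp
    have := hqU hp.1 hp.2 ((hzero p (Finset.mem_product.2 hp) hpU).trans (hzero q hq hqU).symm)
    exact hpq (Prod.ext this.1 this.2)
  have h1 : (DirectSum.decompose 𝒜 (u : E)).support.card = 1 := by
    have h1 := hsupp _ u.ne_zero
    have h2 := hsupp _ (u⁻¹).ne_zero
    nlinarith
  obtain ⟨γ, hγ⟩ := Finset.card_eq_one.1 h1
  refine ⟨γ, ?_⟩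
  have := DirectSum.sum_support_decompose 𝒜 (u : E)
  rw [hγ, Finset.sum_singleton] at this
  rw [← this]
  exact SetLike.coe_mem _

end GradedDivision

/-! ### The reduced norm of a ring generated by a division ring and central elements -/

instance isCentral_subringCenter (D : Type*) [DivisionRing D] :
    Algebra.IsCentral (Subring.center D) D where
  out x hx := ⟨⟨x, Subring.mem_center_iff.2 fun y => (Subalgebra.mem_center_iff.1 hx y)⟩, rfl⟩

/-- The fraction field is flat over the center, so it embeds in the tensor product. Nontriviality is
what makes a map from a simple ring into q(E) injective. -/
theorem nontrivial_fractionRing_tensorProduct (E : Type*) [Ring E] [IsDomain (Subring.center E)] :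
    Nontrivial (FractionRing (Subring.center E) ⊗[Subring.center E] E) := by
  have : Module.Flat (Subring.center E) (FractionRing (Subring.center E)) :=
    IsLocalization.flat _ (nonZeroDivisors (Subring.center E))
  exact (Algebra.TensorProduct.includeLeft_injective (R := Subring.center E)
    (S := Subring.center E) (A := FractionRing (Subring.center E)) (B := E)
    Subtype.val_injective).nontrivial

/-- If `E` is finite over its center, and generated over it by a division ring `D` whose center
is central in `E`, then the reduced norms of `E` and `D` agree on `D`. -/
theorem exists_gradedReducedNorm_eq {D E : Type*} [DivisionRing D] [Ring E]
    [IsDomain (Subring.center E)] [Module.Finite (Subring.center E) E] (f : D →+* E)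
    (hcen : ∀ c ∈ Subring.center D, f c ∈ Subring.center E)
    (hspan : Submodule.span (Subring.center E) (Set.range f) = ⊤) :
    ∃ ι : AlgebraicClosure (Subring.center D) →+*
        AlgebraicClosure (FractionRing (Subring.center E)),
      ∀ d, gradedReducedNorm E (f d) = ι (reducedNorm (Subring.center D) D d) := by
  have := nontrivial_fractionRing_tensorProduct E
  let i : Subring.center D →+* Subring.center E :=
    (f.comp (Subring.center D).subtype).codRestrict _ fun c => hcen c c.2
  let k : Subring.center D →+* FractionRing (Subring.center E) := (algebraMap _ _).comp i
  -- Since `f` carries the center of `D` into that of `E`, q(T) is an extension field of Z(D).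
  let _ : Algebra (Subring.center D) (FractionRing (Subring.center E)) := k.toAlgebra
  let inc : E →ₐ[Subring.center E] FractionRing (Subring.center E) ⊗[Subring.center E] E :=
    Algebra.TensorProduct.includeRight
  let j : D →ₐ[Subring.center D] FractionRing (Subring.center E) ⊗[Subring.center E] E :=
    { (inc : E →+* _).comp f with
      commutes' := fun c => (inc.commutes (i c)).trans
        (IsScalarTower.algebraMap_apply _ (FractionRing (Subring.center E)) _ _) }
  refine exists_reducedNorm_eq j ?_
  rw [eq_top_iff]
  rintro x -
  have hinc : ∀ e : E, (1 : FractionRing (Subring.center E)) ⊗ₜ[Subring.center E] e ∈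
      Submodule.span (FractionRing (Subring.center E)) (Set.range j) := by
    intro e
    have he : e ∈ Submodule.span (Subring.center E) (Set.range f) := hspan ▸ Submodule.mem_top
    induction he using Submodule.span_induction with
    | mem e he =>
      obtain ⟨d, rfl⟩ := he
      exact Submodule.subset_span ⟨d, rfl⟩
    | zero => simp
    | add a b _ _ ha hb => rw [TensorProduct.tmul_add]; exact add_mem ha hb
    | smul t e _ he =>
      rw [TensorProduct.tmul_smul, ← algebraMap_smul (FractionRing (Subring.center E)) t]
      exact Submodule.smul_mem _ _ he
  induction x with
  | zero => exact zero_mem _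
  | tmul c e => simpa [TensorProduct.smul_tmul'] using Submodule.smul_mem _ c (hinc e)
  | add a b ha hb => exact add_mem ha hb

/-! ### Unramified graded division rings -/

section Unramified

variable {Γ E : Type*} [AddCommGroup Γ] [DecidableEq Γ] [Ring E]
  (𝒜 : Γ → AddSubgroup E) [GradedRing 𝒜]

/-- The inclusion of the degree-zero component. -/
def zeroInclusion : 𝒜 0 →+* E := (SetLike.GradeZero.subring 𝒜).subtype

variable {𝒜}

/-- A homogeneous element of the degree of a homogeneous unit `r` is the product of an element of
degree zero and `r`. -/
theorem exists_zeroInclusion_mul_eq {γ : Γ} {a : E} (ha : a ∈ 𝒜 γ) {r : Eˣ} (hr : (r : E) ∈ 𝒜 γ) :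
    ∃ b : 𝒜 0, zeroInclusion 𝒜 b * r = a := by
  refine ⟨⟨a * ((r⁻¹ : Eˣ) : E), ?_⟩, Units.inv_mul_cancel_right _ _⟩
  have := SetLike.GradedMul.mul_mem ha (units_inv_mem 𝒜 hr)
  rwa [add_neg_cancel] at this

/-- Dividing a nonzero homogeneous element by a central unit of the same degree leaves an element of
degree zero. -/
theorem span_range_zeroInclusion
    (h : ∀ γ, ∀ a ∈ 𝒜 γ, a ≠ 0 → ∃ r : Eˣ, (r : E) ∈ 𝒜 γ ∧ (r : E) ∈ Subring.center E) :
    Submodule.span (Subring.center E) (Set.range (zeroInclusion 𝒜)) = ⊤ := by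
  rw [eq_top_iff]
  rintro x -
  induction x using DirectSum.Decomposition.inductionOn 𝒜 with
  | zero => exact zero_mem _
  | @homogeneous γ a =>
    by_cases ha : (a : E) = 0
    · rw [ha]; exact zero_mem _
    · obtain ⟨r, hr, hrc⟩ := h γ a a.2 ha
      obtain ⟨b, hb⟩ := exists_zeroInclusion_mul_eq a.2 hr
      rw [← hb, Subring.mem_center_iff.1 hrc]
      exact Submodule.smul_mem _ (⟨r, hrc⟩ : Subring.center E) (Submodule.subset_span ⟨b, rfl⟩)
  | add a b ha hb => exact add_mem ha hb

/-- Commuting with E₀ suffices, because E₀ spans E over the center. -/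
theorem zeroInclusion_mem_center
    (h : ∀ γ, ∀ a ∈ 𝒜 γ, a ≠ 0 → ∃ r : Eˣ, (r : E) ∈ 𝒜 γ ∧ (r : E) ∈ Subring.center E)
    {c : 𝒜 0} (hc : c ∈ Subring.center (𝒜 0)) :
    zeroInclusion 𝒜 c ∈ Subring.center E := by
  rw [Subring.mem_center_iff]
  intro x
  have hx : x ∈ Submodule.span (Subring.center E) (Set.range (zeroInclusion 𝒜)) :=
    span_range_zeroInclusion h ▸ Submodule.mem_top
  induction hx using Submodule.span_induction with
  | mem x hx =>
    obtain ⟨d, rfl⟩ := hx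
    rw [← map_mul, ← map_mul, Subring.mem_center_iff.1 hc d]
  | zero => simp
  | add a b _ _ ha hb => rw [add_mul, mul_add, ha, hb]
  | smul t a _ ha => rw [smul_mul_assoc, ha, mul_smul_comm]

end Unramified

end UnitarySK

theorem corollary4p8 {Γ E : Type*} [AddCommGroup Γ] [IsAddTorsionFree Γ] [DecidableEq Γ] [Ring E]
    (𝒜 : Γ → AddSubgroup E) [GradedRing 𝒜] [UnitarySK.GradedDivisionRing 𝒜]
    [Module.Finite (Subring.center E) E]
    (τ : RingInvo E) (hτ : UnitarySK.IsGradedInvo 𝒜 τ) (hunit : UnitarySK.IsUnitary τ)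
    (hET : UnitarySK.gradeSet 𝒜 ⊤ = UnitarySK.gradeSet 𝒜 (Subring.center E))
    (hTR : UnitarySK.gradeSet 𝒜 (Subring.center E) =
      UnitarySK.gradeSet 𝒜 (UnitarySK.centerFixed τ)) :
    Nonempty (UnitarySK.GradedSK₁ 𝒜 τ ≃*
      UnitarySK.SK₁ (𝒜 0) (UnitarySK.restrictZero 𝒜 τ hτ)) := by
  -- The two equalities of grade sets combine to supply a symmetric central unit in every degree
  -- that occurs.
  have hR : ∀ γ, ∀ a ∈ 𝒜 γ, a ≠ 0 → ∃ r : Eˣ, (r : E) ∈ 𝒜 γ ∧ (r : E) ∈ Subring.center E ∧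
      UnitarySK.unitsInvo τ r = r := by
    intro γ a ha ha0
    have hγ : γ ∈ UnitarySK.gradeSet 𝒜 (UnitarySK.centerFixed τ) := by
      rw [← hTR, ← hET]
      exact ⟨a, Subring.mem_top a, ha, ha0⟩
    obtain ⟨r, ⟨hrc, hrτ⟩, hr, hr0⟩ := hγ
    obtain ⟨r, rfl⟩ := UnitarySK.GradedDivisionRing.isUnit γ r hr hr0
    exact ⟨r, hr, hrc, Units.ext hrτ⟩
  have hT : ∀ γ, ∀ a ∈ 𝒜 γ, a ≠ 0 → ∃ r : Eˣ, (r : E) ∈ 𝒜 γ ∧ (r : E) ∈ Subring.center E :=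
    fun γ a ha ha0 => (hR γ a ha ha0).imp fun r hr => ⟨hr.1, hr.2.1⟩
  have hinj : Function.Injective (UnitarySK.zeroInclusion 𝒜) := Subtype.val_injective
  have := UnitarySK.isDomain_center 𝒜
  have := UnitarySK.GradedDivisionRing.nontrivial (𝒜 := 𝒜)
  obtain ⟨ι, hι⟩ := UnitarySK.exists_gradedReducedNorm_eq (UnitarySK.zeroInclusion 𝒜)
    (fun c hc => UnitarySK.zeroInclusion_mem_center hT hc) (UnitarySK.span_range_zeroInclusion hT)
  refine UnitarySK.nonempty_sigmaPrime_quotient_mulEquiv (f := UnitarySK.zeroInclusion 𝒜) _ _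
    (ι : _ →* _) ι.injective hι hinj (fun _ => rfl) fun u => ?_
  -- Homogeneity of `u` yields the factorization `u = b * r`, with `b` nonzero in the division ring
  -- E₀.
  obtain ⟨γ, hγ⟩ := UnitarySK.exists_mem_of_units 𝒜 u
  obtain ⟨r, hr, hrc, hrτ⟩ := hR γ u hγ u.ne_zero
  obtain ⟨b, hb⟩ := UnitarySK.exists_zeroInclusion_mul_eq hγ hr
  have hb0 : b ≠ 0 := by
    rintro rfl
    rw [map_zero, zero_mul] at hb
    exact u.ne_zero hb.symm
  exact ⟨Units.mk0 b hb0, r, hrc, hrτ, Units.ext hb.symm⟩
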